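/- Let $n\ge 0$ be an integer and let $|\cdot|$ be the Euclidean norm on $\mathbb R^n$. Let $\mathrm{Conv}(\mathbb R^n)$ be the set of convex, lower semicontinuous functions $u\colon\mathbb R^n\to\mathbb R\cup\{+\infty\}$ with $u\not\equiv+\infty$, and set $$\mathrm{Conv}_{sc}(\mathbb R^n)=\Big\{u\in\mathrm{Conv}(\mathbb R^n):\lim_{|x|\to\infty}\frac{u(x)}{|x|}=+\infty\Big\},\qquad \mathrm{Conv}(\mathbb R^n;\mathbb R)=\{v\in\mathrm{Conv}(\mathbb R^n): v(x)<+\infty\text{ for all }x\}.$$ A sequence $u_k$ epi-converges to $u$ if, for every $x\in\mathbb R^n$, one has $u(x)\le\liminf_k u_k(x_k)$ for every sequence $x_k\to x$, and $u(x)=\lim_k u_k(x_k)$ for some sequence $x_k\to x$. Let $X$ be one of the two spaces above. A functional $Z\colon X\to\mathbb R$ is continuous if $Z(u_k)\to Z(u)$ whenever $u_k,u\in X$ and $u_k$ epi-converges to $u$. It is a valuation if $Z(u\vee v)+Z(u\wedge v)=Z(u)+Z(v)$ for all $u,v\in X$ whose pointwise maximum $u\vee v$ and pointwise minimum $u\wedge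 v$ belong to $X$. A functional $Z\colon\mathrm{Conv}_{sc}(\mathbb R^n)\to\mathbb R$ is epi-translation invariant if $Z(u(\cdot-a))=Z(u)$ and $Z(u+c)=Z(u)$ for all $u\in\mathrm{Conv}_{sc}(\mathbb R^n)$, $a\in\mathbb R^n$ and $c\in\mathbb R$. It is epi-homogeneous of degree $0$ if $Z\big(\lambda\,u(\cdot/\lambda)\big)=Z(u)$ for all $u\in\mathrm{Conv}_{sc}(\mathbb R^n)$ and $\lambda>0$. A functional $Z\colon\mathrm{Conv}(\mathbb R^n;\mathbb R)\to\mathbb R$ is dually epi-translation invariant if $Z(v+\ell)=Z(v)$ and $Z(v+c)=Z(v)$ for all $v\in\mathrm{Conv}(\mathbb R^n;\mathbb R)$, all linear $\ell\colon\mathbb R^n\to\mathbb R$ and all $c\in\mathbb R$. It is homogeneous of degree $0$ if $Z(\lambda v)=Z(v)$ for all $v\in\mathrm{Conv}(\mathbb R^n;\mathbb R)$ and $\lambda\ge 0$. **Theorem.** 1. A functional $Z\colon\mathrm{Conv}_{sc}(\mathbb R^n)\to\mathbb R$ is a continuous and epi-translation invariant valuation that is epi-homogeneous of degree $0$ if and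 only if $Z$ is constant. 2. A functional $Z\colon\mathrm{Conv}(\mathbb R^n;\mathbb R)\to\mathbb R$ is a continuous and dually epi-translation invariant valuation that is homogeneous of degree $0$ if and only if $Z$ is constant. The same equivalence holds if in the definition of homogeneity the identity $Z(\lambda v)=Z(v)$ is required only for $\lambda>0$. -/

import Mathlib

open Filter Topology

namespace ConvVal

/-- Euclidean space `ℝⁿ`. -/
abbrev E (n : ℕ) : Type := EuclideanSpace ℝ (Fin n)

/-- `Conv(ℝⁿ)`: the convex, lower semicontinuous functions `ℝⁿ → ℝ ∪ {+∞}` that are not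
identically `+∞`. Convexity of an extended real valued function is convexity of its epigraph. -/
structure IsConv {n : ℕ} (u : E n → EReal) : Prop where
  ne_bot : ∀ x, u x ≠ ⊥
  convex : Convex ℝ {p : E n × ℝ | u p.1 ≤ (p.2 : EReal)}
  lsc : LowerSemicontinuous u
  proper : ∃ x, u x ≠ ⊤

/-- `u(x) / |x| → +∞` as `|x| → +∞`. -/
def IsSuperCoercive {n : ℕ} (u : E n → EReal) : Prop :=
  Tendsto (fun x => u x / (‖x‖ : EReal)) (comap (fun x : E n => ‖x‖) atTop) (𝓝 ⊤)

/-- `Conv_sc(ℝⁿ)`: the super-coercive functions in `Conv(ℝⁿ)`. -/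
def ConvSC (n : ℕ) : Set (E n → EReal) := {u | IsConv u ∧ IsSuperCoercive u}

/-- `Conv(ℝⁿ; ℝ)`: the functions in `Conv(ℝⁿ)` that are finite everywhere. -/
def ConvFin (n : ℕ) : Set (E n → EReal) := {v | IsConv v ∧ ∀ x, v x < ⊤}

/-- The sequence `u k` epi-converges to `w`. -/
def EpiConverges {n : ℕ} (u : ℕ → E n → EReal) (w : E n → EReal) : Prop :=
  ∀ x : E n,
    (∀ y : ℕ → E n, Tendsto y atTop (𝓝 x) → w x ≤ liminf (fun k => u k (y k)) atTop) ∧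
    ∃ y : ℕ → E n, Tendsto y atTop (𝓝 x) ∧ Tendsto (fun k => u k (y k)) atTop (𝓝 (w x))

/-- Continuity of a functional on a space `X` of functions with respect to epi-convergence. -/
def IsEpiContinuous {n : ℕ} {X : Set (E n → EReal)} (Z : X → ℝ) : Prop :=
  ∀ (u : ℕ → X) (w : X), EpiConverges (fun k => (u k : E n → EReal)) w →
    Tendsto (fun k => Z (u k)) atTop (𝓝 (Z w))

/-- Valuations on a space `X` of functions; `⊔` and `⊓` are the pointwise maximum and minimum. -/
def IsValuation {n : ℕ} {X : Set (E n → EReal)} (Z : X → ℝ) : Prop :=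
  ∀ (u v : X) (hs : (u : E n → EReal) ⊔ v ∈ X) (hi : (u : E n → EReal) ⊓ v ∈ X),
    Z ⟨(u : E n → EReal) ⊔ v, hs⟩ + Z ⟨(u : E n → EReal) ⊓ v, hi⟩ = Z u + Z v

/-- `u ∘ τ⁻¹` for the translation `τ x = x + a`. -/
def translate {n : ℕ} (a : E n) (u : E n → EReal) : E n → EReal := fun x => u (x - a)

/-- `u + c` for a constant `c`. -/
noncomputable def addConst {n : ℕ} (c : ℝ) (u : E n → EReal) : E n → EReal := fun x => u x + (c : EReal)

/-- The epi-multiplication `x ↦ r u(x / r)`, used for `r > 0`. -/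
noncomputable def epiMul {n : ℕ} (r : ℝ) (u : E n → EReal) : E n → EReal :=
  fun x => (r : EReal) * u (r⁻¹ • x)

/-- `v + ℓ` for a linear function `ℓ`. -/
noncomputable def addLinear {n : ℕ} (l : E n →ₗ[ℝ] ℝ) (v : E n → EReal) : E n → EReal :=
  fun x => v x + (l x : EReal)

/-- The multiple `r v`, used for `r ≥ 0` and finite-valued `v`. -/
noncomputable def scale {n : ℕ} (r : ℝ) (v : E n → EReal) : E n → EReal := fun x => (r : EReal) * v x

/-! The spaces are closed under the operations above. -/

theorem add_coe_le {a : EReal} {c s : ℝ} : a + (c : EReal) ≤ s ↔ a ≤ ((s - c : ℝ) : EReal) := by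
  rw [EReal.coe_sub]
  exact (EReal.le_sub_iff_add_le (Or.inl (EReal.coe_ne_bot c)) (Or.inl (EReal.coe_ne_top c))).symm

theorem coe_mul_le {a : EReal} {r s : ℝ} (hr : 0 < r) :
    (r : EReal) * a ≤ s ↔ a ≤ ((r⁻¹ * s : ℝ) : EReal) := by
  induction a with
  | bot => simp [EReal.coe_mul_bot_of_pos hr]
  | top => simp [EReal.coe_mul_top_of_pos hr, -EReal.coe_mul]
  | coe a =>
    rw [← EReal.coe_mul, EReal.coe_le_coe_iff, EReal.coe_le_coe_iff, le_inv_mul_iff₀ hr]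

theorem coe_mul_ne_bot {a : EReal} {r : ℝ} (hr : 0 < r) (ha : a ≠ ⊥) : (r : EReal) * a ≠ ⊥ := by
  induction a with
  | bot => exact absurd rfl ha
  | top => simp [EReal.coe_mul_top_of_pos hr]
  | coe a => rw [← EReal.coe_mul]; exact EReal.coe_ne_bot _

theorem coe_mul_ne_top {a : EReal} {r : ℝ} (hr : 0 < r) (ha : a ≠ ⊤) : (r : EReal) * a ≠ ⊤ := by
  induction a with
  | top => exact absurd rfl ha
  | bot => simp [EReal.coe_mul_bot_of_pos hr]
  | coe a => rw [← EReal.coe_mul]; exact EReal.coe_ne_top _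

theorem lsc_coe_mul {n : ℕ} {u : E n → EReal} {r : ℝ} (hr : 0 < r) (hu : LowerSemicontinuous u) :
    LowerSemicontinuous fun x => (r : EReal) * u x := by
  intro x y hy
  have key : ∀ b : EReal, y < (r : EReal) * b ↔ ((r⁻¹ : ℝ) : EReal) * y < b := by
    intro b
    have h1 : ((r⁻¹ : ℝ) : EReal) * y = y / (r : EReal) := by
      rw [EReal.div_eq_inv_mul, EReal.coe_inv]
    rw [h1, EReal.div_lt_iff (by exact_mod_cast hr) (EReal.coe_ne_top r), mul_comm]
  have hy := (key _).1 hy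
  filter_upwards [hu x _ hy] with z hz
  exact (key _).2 hz

theorem IsConv.add_affine {n : ℕ} {u : E n → EReal} (hu : IsConv u) (l : E n →ₗ[ℝ] ℝ) (c : ℝ) :
    IsConv fun x => u x + ((l x + c : ℝ) : EReal) where
  ne_bot x := EReal.add_ne_bot_iff.2 ⟨hu.ne_bot x, EReal.coe_ne_bot _⟩
  convex := by
    rintro ⟨x, s⟩ hx ⟨y, t⟩ hy a b ha hb hab
    simp only [Set.mem_ofPred_eq, add_coe_le] at hx hy ⊢
    have h := hu.convex (x := (x, s - (l x + c))) hx (y := (y, t - (l y + c))) hy ha hb hab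
    simp only [Set.mem_ofPred_eq, Prod.smul_mk, Prod.mk_add_mk, smul_eq_mul, map_add,
      map_smul] at h ⊢
    convert h using 2
    linear_combination c * hab
  lsc := by
    refine hu.lsc.add' ?_ fun x => EReal.continuousAt_add (Or.inr (EReal.coe_ne_bot _))
      (Or.inr (EReal.coe_ne_top _))
    have hl : Continuous l := l.continuous_of_finiteDimensional
    exact (continuous_coe_real_ereal.comp (hl.add continuous_const)).lowerSemicontinuous
  proper := by
    obtain ⟨x, hx⟩ := hu.proper
    exact ⟨x, (EReal.add_lt_top hx (EReal.coe_ne_top _)).ne⟩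

theorem IsConv.addConst {n : ℕ} {u : E n → EReal} (hu : IsConv u) (c : ℝ) :
    IsConv (addConst c u) := by
  simpa [ConvVal.addConst] using! hu.add_affine 0 c

theorem IsConv.addLinear {n : ℕ} {u : E n → EReal} (hu : IsConv u) (l : E n →ₗ[ℝ] ℝ) :
    IsConv (addLinear l u) := by
  simpa [ConvVal.addLinear] using! hu.add_affine l 0

theorem IsConv.translate {n : ℕ} {u : E n → EReal} (hu : IsConv u) (a : E n) :
    IsConv (translate a u) where
  ne_bot x := hu.ne_bot _
  convex := by
    rintro ⟨x, s⟩ hx ⟨y, t⟩ hy p q hp hq hpq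
    have h := hu.convex (x := (x - a, s)) hx (y := (y - a, t)) hy hp hq hpq
    have e : p • (x - a) + q • (y - a) = p • x + q • y - a := by
      have : a = (p + q) • a := by rw [hpq, one_smul]
      nth_rw 3 [this]
      module
    simpa [ConvVal.translate, e] using h
  lsc := fun x => by
    have hc : Continuous (fun x : E n => x - a) := by fun_prop
    exact fun y hy => hc.continuousAt.eventually (hu.lsc _ y hy)
  proper := by
    obtain ⟨x, hx⟩ := hu.proper
    exact ⟨x + a, by simpa [ConvVal.translate] using hx⟩

theorem IsConv.scale {n : ℕ} {u : E n → EReal} (hu : IsConv u) {r : ℝ} (hr : 0 < r) :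
    IsConv (scale r u) where
  ne_bot x := coe_mul_ne_bot hr (hu.ne_bot x)
  convex := by
    rintro ⟨x, s⟩ hx ⟨y, t⟩ hy p q hp hq hpq
    simp only [ConvVal.scale, Set.mem_ofPred_eq, coe_mul_le hr] at hx hy ⊢
    have h := hu.convex (x := (x, r⁻¹ * s)) hx (y := (y, r⁻¹ * t)) hy hp hq hpq
    simp only [Set.mem_ofPred_eq, Prod.smul_mk, Prod.mk_add_mk, smul_eq_mul] at h ⊢
    convert h using 2
    ring
  lsc := lsc_coe_mul hr hu.lsc
  proper := by
    obtain ⟨x, hx⟩ := hu.proper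
    exact ⟨x, coe_mul_ne_top hr hx⟩

theorem IsConv.comp_smul {n : ℕ} {u : E n → EReal} (hu : IsConv u) {r : ℝ} (hr : 0 < r) :
    IsConv fun x => u (r⁻¹ • x) where
  ne_bot x := hu.ne_bot _
  convex := by
    rintro ⟨x, s⟩ hx ⟨y, t⟩ hy p q hp hq hpq
    have h := hu.convex (x := (r⁻¹ • x, s)) hx (y := (r⁻¹ • y, t)) hy hp hq hpq
    have e : r⁻¹ • (p • x + q • y) = p • r⁻¹ • x + q • r⁻¹ • y := by module
    simpa only [Set.mem_ofPred_eq, Prod.smul_mk, Prod.mk_add_mk, e] using h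
  lsc := fun x => by
    have hc : Continuous (fun x : E n => r⁻¹ • x) := by fun_prop
    exact fun y hy => hc.continuousAt.eventually (hu.lsc _ y hy)
  proper := by
    obtain ⟨x, hx⟩ := hu.proper
    exact ⟨r • x, by simpa [smul_smul, inv_mul_cancel₀ hr.ne'] using hx⟩

theorem IsConv.epiMul {n : ℕ} {u : E n → EReal} (hu : IsConv u) {r : ℝ} (hr : 0 < r) :
    IsConv (epiMul r u) := (hu.comp_smul hr).scale hr

theorem isConv_zero {n : ℕ} : IsConv fun _ : E n => (0 : EReal) where
  ne_bot x := by simp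
  convex := by
    rintro ⟨x, s⟩ hx ⟨y, t⟩ hy p q hp hq -
    simp only [Set.mem_ofPred_eq, Prod.smul_mk, Prod.mk_add_mk, smul_eq_mul,
      EReal.coe_nonneg] at hx hy ⊢
    positivity
  lsc := continuous_const.lowerSemicontinuous
  proper := ⟨0, by simp⟩

theorem isSuperCoercive_iff {n : ℕ} {u : E n → EReal} :
    IsSuperCoercive u ↔
      ∀ M : ℝ, ∃ R : ℝ, ∀ x : E n, R ≤ ‖x‖ → ((M * ‖x‖ : ℝ) : EReal) ≤ u x := by
  have hb : (comap (fun x : E n => ‖x‖) atTop).HasBasis (fun _ : ℝ => True)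
      fun R => {x | R ≤ ‖x‖} := atTop_basis.comap _
  rw [IsSuperCoercive, EReal.tendsto_nhds_top_iff_real]
  constructor
  · intro h M
    obtain ⟨R, -, hR⟩ := hb.eventually_iff.1 (h M)
    refine ⟨max R 1, fun x hx => ?_⟩
    have hpos : 0 < ‖x‖ := lt_of_lt_of_le one_pos ((le_max_right _ _).trans hx)
    have h1 := hR (x := x) ((le_max_left _ _).trans hx)
    rw [EReal.lt_div_iff (by exact_mod_cast hpos) (EReal.coe_ne_top _)] at h1
    rw [EReal.coe_mul]
    exact h1.le
  · intro h M
    obtain ⟨R, hR⟩ := h (M + 1)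
    refine hb.eventually_iff.2 ⟨max R 1, trivial, fun x hx => ?_⟩
    have hpos : 0 < ‖x‖ := lt_of_lt_of_le one_pos ((le_max_right _ _).trans hx)
    rw [EReal.lt_div_iff (by exact_mod_cast hpos) (EReal.coe_ne_top _), ← EReal.coe_mul]
    refine lt_of_lt_of_le ?_ (hR x ((le_max_left _ _).trans hx))
    rw [EReal.coe_lt_coe_iff]
    nlinarith

theorem translate_mem {n : ℕ} {u : E n → EReal} (hu : u ∈ ConvSC n) (a : E n) :
    translate a u ∈ ConvSC n := by
  refine ⟨hu.1.translate a, isSuperCoercive_iff.2 fun M => ?_⟩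
  obtain ⟨R, hR⟩ := isSuperCoercive_iff.1 hu.2 (|M| * 2)
  refine ⟨max (R + ‖a‖) (2 * ‖a‖), fun x hx => ?_⟩
  have h1 := (le_max_left _ _).trans hx
  have h2 := (le_max_right _ _).trans hx
  have h3 := norm_sub_norm_le x a
  refine le_trans ?_ (hR (x - a) (by linarith))
  rw [EReal.coe_le_coe_iff]
  have h4 : M * ‖x‖ ≤ |M| * ‖x‖ := mul_le_mul_of_nonneg_right (le_abs_self M) (norm_nonneg x)
  have h5 : |M| * ‖x‖ ≤ |M| * (2 * ‖x - a‖) :=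
    mul_le_mul_of_nonneg_left (by linarith) (abs_nonneg M)
  linarith

theorem addConst_mem {n : ℕ} {u : E n → EReal} (hu : u ∈ ConvSC n) (c : ℝ) :
    addConst c u ∈ ConvSC n := by
  refine ⟨hu.1.addConst c, isSuperCoercive_iff.2 fun M => ?_⟩
  obtain ⟨R, hR⟩ := isSuperCoercive_iff.1 hu.2 (M + |c|)
  refine ⟨max R 1, fun x hx => ?_⟩
  have h1 := (le_max_right _ _).trans hx
  have h2 : ((((M + |c|) * ‖x‖ : ℝ)) : EReal) + (c : EReal) ≤ addConst c u x :=
    add_le_add_left (hR x ((le_max_left _ _).trans hx)) _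
  refine le_trans ?_ h2
  rw [← EReal.coe_add, EReal.coe_le_coe_iff]
  nlinarith [neg_abs_le c, abs_nonneg c]

theorem epiMul_mem {n : ℕ} {u : E n → EReal} (hu : u ∈ ConvSC n) {r : ℝ} (hr : 0 < r) :
    epiMul r u ∈ ConvSC n := by
  refine ⟨hu.1.epiMul hr, isSuperCoercive_iff.2 fun M => ?_⟩
  obtain ⟨R, hR⟩ := isSuperCoercive_iff.1 hu.2 M
  refine ⟨r * R, fun x hx => ?_⟩
  have hn : ‖r⁻¹ • x‖ = r⁻¹ * ‖x‖ := by rw [norm_smul, Real.norm_of_nonneg (inv_pos.2 hr).le]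
  have h := hR (r⁻¹ • x) (by rw [hn, le_inv_mul_iff₀ hr]; exact hx)
  have h2 := mul_le_mul_of_nonneg_left h (show (0 : EReal) ≤ (r : EReal) by exact_mod_cast hr.le)
  refine le_trans (le_of_eq ?_) h2
  rw [← EReal.coe_mul, hn]
  congr 1
  field_simp

theorem addConst_mem_fin {n : ℕ} {v : E n → EReal} (hv : v ∈ ConvFin n) (c : ℝ) :
    addConst c v ∈ ConvFin n :=
  ⟨hv.1.addConst c, fun x => EReal.add_lt_top (hv.2 x).ne (EReal.coe_ne_top _)⟩

theorem addLinear_mem {n : ℕ} {v : E n → EReal} (hv : v ∈ ConvFin n) (l : E n →ₗ[ℝ] ℝ) :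
    addLinear l v ∈ ConvFin n :=
  ⟨hv.1.addLinear l, fun x => EReal.add_lt_top (hv.2 x).ne (EReal.coe_ne_top _)⟩

theorem scale_mem {n : ℕ} {v : E n → EReal} (hv : v ∈ ConvFin n) {r : ℝ} (hr : 0 ≤ r) :
    scale r v ∈ ConvFin n := by
  rcases hr.eq_or_lt with rfl | hr
  · have : scale 0 v = fun _ => (0 : EReal) := by funext x; simp [scale]
    rw [this]
    exact ⟨isConv_zero, fun x => by simp⟩
  · exact ⟨hv.1.scale hr, fun x => (coe_mul_ne_top hr (hv.2 x).ne).lt_top⟩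

/-- Invariance under translations of `ℝⁿ` and under the addition of constants. -/
def IsEpiTranslationInvariant {n : ℕ} (Z : ConvSC n → ℝ) : Prop :=
  (∀ (u : ConvSC n) (a : E n), Z ⟨translate a u, translate_mem u.2 a⟩ = Z u) ∧
  ∀ (u : ConvSC n) (c : ℝ), Z ⟨addConst c u, addConst_mem u.2 c⟩ = Z u

/-- `Z` is epi-homogeneous of degree `α`. -/
def IsEpiHomogeneous {n : ℕ} (α : ℝ) (Z : ConvSC n → ℝ) : Prop :=
  ∀ (u : ConvSC n) (r : ℝ) (hr : 0 < r), Z ⟨epiMul r u, epiMul_mem u.2 hr⟩ = r ^ α * Z u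

/-- Invariance under the addition of linear functions and of constants. -/
def IsDuallyEpiTranslationInvariant {n : ℕ} (Z : ConvFin n → ℝ) : Prop :=
  (∀ (v : ConvFin n) (l : E n →ₗ[ℝ] ℝ), Z ⟨addLinear l v, addLinear_mem v.2 l⟩ = Z v) ∧
  ∀ (v : ConvFin n) (c : ℝ), Z ⟨addConst c v, addConst_mem_fin v.2 c⟩ = Z v

/-- `Z(r v) = r ^ α Z(v)` for all `r ≥ 0` (with `0 ^ 0 = 1`). -/
def IsHomogeneous {n : ℕ} (α : ℝ) (Z : ConvFin n → ℝ) : Prop :=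
  ∀ (v : ConvFin n) (r : ℝ) (hr : 0 ≤ r), Z ⟨scale r v, scale_mem v.2 hr⟩ = r ^ α * Z v

/-- `Z(r v) = r ^ α Z(v)` for all `r > 0` only. -/
def IsPositivelyHomogeneous {n : ℕ} (α : ℝ) (Z : ConvFin n → ℝ) : Prop :=
  ∀ (v : ConvFin n) (r : ℝ) (hr : 0 < r), Z ⟨scale r v, scale_mem v.2 hr.le⟩ = r ^ α * Z v

end ConvVal

namespace ConvVal

/-! Homogeneity of degree 0 makes `Z` constant along each scaling orbit, and as the factor tends to
0 all orbits epi-converge to one common function. Continuity then forces `Z` to take the same value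
everywhere. On `ConvSC n` the epigraph of `epiMul r u` is the epigraph of `u` dilated by `r`;
super-coercivity makes it collapse to the vertical half-line over the origin, the epigraph of
`indicatorZero n` (`epiConverges_epiMul`). On `ConvFin n` the limit of `scale r v` is the zero
function (`epiConverges_scale`). Only positive factors occur in these limits, so the weaker form of
homogeneity suffices. -/

/-! ### Super-coercive functions and the indicator of the origin -/

/-- The convex indicator function of the origin. -/
noncomputable def indicatorZero (n : ℕ) : E n → EReal := fun x => if x = 0 then 0 else ⊤

theorem indicatorZero_nonneg {n : ℕ} (x : E n) : 0 ≤ indicatorZero n x := by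
  unfold indicatorZero
  split_ifs <;> simp

theorem indicatorZero_le_coe_iff {n : ℕ} (x : E n) (s : ℝ) :
    indicatorZero n x ≤ s ↔ x = 0 ∧ 0 ≤ s := by
  unfold indicatorZero
  split_ifs with h <;> simp [h]

theorem isConv_indicatorZero (n : ℕ) : IsConv (indicatorZero n) where
  ne_bot x := ((EReal.bot_lt_zero).trans_le (indicatorZero_nonneg x)).ne'
  convex := by
    rintro ⟨x, s⟩ hx ⟨y, t⟩ hy p q hp hq -
    simp only [Set.mem_ofPred_eq, indicatorZero_le_coe_iff, Prod.smul_mk, Prod.mk_add_mk,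
      smul_eq_mul] at hx hy ⊢
    obtain ⟨rfl, hs⟩ := hx
    obtain ⟨rfl, ht⟩ := hy
    exact ⟨by simp, by positivity⟩
  lsc := by
    intro x y hy
    by_cases hx : x = 0
    · refine Eventually.of_forall fun z => lt_of_lt_of_le ?_ (indicatorZero_nonneg z)
      simpa [indicatorZero, hx] using hy
    · filter_upwards [isOpen_ne.mem_nhds hx] with z hz
      have hz : z ≠ 0 := hz
      simpa [indicatorZero, hx, hz] using hy
  proper := ⟨0, by simp [indicatorZero]⟩

theorem indicatorZero_mem (n : ℕ) : indicatorZero n ∈ ConvSC n := by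
  refine ⟨isConv_indicatorZero n, isSuperCoercive_iff.2 fun M => ⟨1, fun x hx => ?_⟩⟩
  have h : x ≠ 0 := norm_pos_iff.1 (one_pos.trans_le hx)
  simp [indicatorZero, h]

/-- Super-coercivity with slope 0 gives `0 ≤ u` outside a ball; on the ball, lower semicontinuity
and compactness give a minimum. -/
theorem exists_coe_le_of_mem_convSC {n : ℕ} {u : E n → EReal} (hu : u ∈ ConvSC n) :
    ∃ B : ℝ, ∀ x, (B : EReal) ≤ u x := by
  obtain ⟨R, hR⟩ := isSuperCoercive_iff.1 hu.2 0
  obtain ⟨x₀, -, hx₀⟩ := (hu.1.lsc.lowerSemicontinuousOn _).exists_isMinOn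
    (Metric.nonempty_closedBall.2 (le_max_right R 0)) (isCompact_closedBall (0 : E n) (max R 0))
  -- The minimum over the ball may be `⊤`, so a real number below it is chosen.
  obtain ⟨B, -, hB⟩ := EReal.lt_iff_exists_real_btwn.1 (bot_lt_iff_ne_bot.2 (hu.1.ne_bot x₀))
  refine ⟨min B 0, fun x => ?_⟩
  by_cases hx : ‖x‖ ≤ max R 0
  · have h : u x₀ ≤ u x := hx₀ (by simpa using hx)
    refine le_trans ?_ (hB.le.trans h)
    exact_mod_cast min_le_left B 0
  · have h := hR x ((le_max_left R 0).trans (not_le.1 hx).le)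
    refine le_trans ?_ h
    rw [zero_mul]
    exact_mod_cast min_le_right B 0

/-- At the origin, a lower bound `B` of `u` contributes `r k * B → 0`, and scaling a point of the
domain gives the recovery sequence. Elsewhere the rescaled arguments escape to infinity, where
superlinear growth outweighs the factor `r k`. -/
theorem epiConverges_epiMul {n : ℕ} {u : E n → EReal} (hu : u ∈ ConvSC n) {r : ℕ → ℝ}
    (hr : ∀ k, 0 < r k) (hr0 : Tendsto r atTop (𝓝 0)) :
    EpiConverges (fun k => epiMul (r k) u) (indicatorZero n) := by
  intro x
  by_cases hx : x = 0
  · subst hx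
    have h0 : indicatorZero n 0 = ((0 : ℝ) : EReal) := by simp [indicatorZero]
    rw [h0]
    constructor
    · intro y _
      obtain ⟨B, hB⟩ := exists_coe_le_of_mem_convSC hu
      have hlim : Tendsto (fun k => ((r k * B : ℝ) : EReal)) atTop (𝓝 ((0 : ℝ) : EReal)) := by
        refine (continuous_coe_real_ereal.tendsto 0).comp ?_
        simpa using hr0.mul_const B
      rw [← hlim.liminf_eq]
      refine liminf_le_liminf (Eventually.of_forall fun k => ?_)
      rw [EReal.coe_mul]
      exact mul_le_mul_of_nonneg_left (hB _) (by exact_mod_cast (hr k).le)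
    · obtain ⟨x₀, hx₀⟩ := hu.1.proper
      lift u x₀ to ℝ using ⟨hx₀, hu.1.ne_bot x₀⟩ with c hc
      refine ⟨fun k => r k • x₀, by simpa using hr0.smul_const x₀, ?_⟩
      have he : ∀ k, epiMul (r k) u (r k • x₀) = ((r k * c : ℝ) : EReal) := fun k => by
        rw [epiMul, inv_smul_smul₀ (hr k).ne', ← hc, EReal.coe_mul]
      simp only [he]
      refine (continuous_coe_real_ereal.tendsto 0).comp ?_
      simpa using hr0.mul_const c
  · have htop : indicatorZero n x = ⊤ := by simp [indicatorZero, hx]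
    rw [htop]
    have key : ∀ y : ℕ → E n, Tendsto y atTop (𝓝 x) →
        Tendsto (fun k => epiMul (r k) u (y k)) atTop (𝓝 ⊤) := by
      intro y hy
      rw [EReal.tendsto_nhds_top_iff_real]
      intro M
      have hxpos : 0 < ‖x‖ := norm_pos_iff.2 hx
      -- The factors `r k` and `(r k)⁻¹` cancel, leaving slope times `‖y k‖`; this slope makes the
      -- product exceed `M` once `‖y k‖ > ‖x‖ / 2`.
      obtain ⟨R, hR⟩ := isSuperCoercive_iff.1 hu.2 ((|M| + 1) / (‖x‖ / 2))
      have h1 : ∀ᶠ k in atTop, ‖x‖ / 2 < ‖y k‖ := hy.norm.eventually_const_lt (half_lt_self hxpos)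
      -- Together with `h1`, this puts `(r k)⁻¹ • y k` outside the ball of radius `R`.
      have h2 : ∀ᶠ k in atTop, r k * R < ‖x‖ / 2 :=
        (hr0.mul_const R).eventually_lt_const (by simpa using half_pos hxpos)
      filter_upwards [h1, h2] with k h1 h2
      have hn : ‖(r k)⁻¹ • y k‖ = (r k)⁻¹ * ‖y k‖ := by
        rw [norm_smul, Real.norm_of_nonneg (inv_pos.2 (hr k)).le]
      have h3 := hR ((r k)⁻¹ • y k) (by rw [hn, le_inv_mul_iff₀ (hr k)]; exact (h2.trans h1).le)
      have h4 := mul_le_mul_of_nonneg_left h3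
        (show (0 : EReal) ≤ (r k : EReal) by exact_mod_cast (hr k).le)
      refine lt_of_lt_of_le ?_ h4
      rw [← EReal.coe_mul, EReal.coe_lt_coe_iff, hn]
      have h5 : r k * ((|M| + 1) / (‖x‖ / 2) * ((r k)⁻¹ * ‖y k‖)) =
          (|M| + 1) / (‖x‖ / 2) * ‖y k‖ := by
        have := (hr k).ne'
        field_simp
      rw [h5]
      calc M < |M| + 1 := by linarith [le_abs_self M]
        _ = (|M| + 1) / (‖x‖ / 2) * (‖x‖ / 2) := (div_mul_cancel₀ _ (half_pos hxpos).ne').symm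
        _ ≤ (|M| + 1) / (‖x‖ / 2) * ‖y k‖ := mul_le_mul_of_nonneg_left h1.le (by positivity)
    exact ⟨fun y hy => (key y hy).liminf_eq.ge, fun _ => x, tendsto_const_nhds,
      key _ tendsto_const_nhds⟩

/-! ### Finite convex functions and the zero function -/

/-- A finite convex function on an open set of a finite-dimensional space is continuous. -/
theorem exists_continuous_coe_of_mem_convFin {n : ℕ} {v : E n → EReal} (hv : v ∈ ConvFin n) :
    ∃ f : E n → ℝ, Continuous f ∧ ∀ x, v x = f x := by
  have hf : ∀ x, ((v x).toReal : EReal) = v x := fun x =>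
    EReal.coe_toReal (hv.2 x).ne (hv.1.ne_bot x)
  refine ⟨fun x => (v x).toReal, ?_, fun x => (hf x).symm⟩
  have hconv : ConvexOn ℝ Set.univ fun x => (v x).toReal := by
    refine ⟨convex_univ, fun x _ y _ a b ha hb hab => ?_⟩
    have h := hv.1.convex (x := (x, (v x).toReal)) (hf x).ge (y := (y, (v y).toReal)) (hf y).ge
      ha hb hab
    simp only [Set.mem_ofPred_eq, Prod.smul_mk, Prod.mk_add_mk] at h
    rw [← hf, EReal.coe_le_coe_iff] at h
    exact h
  exact continuousOn_univ.1 (hconv.continuousOn isOpen_univ)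

/-- By continuity the values of `v` converge to a real number along any `y k → x`, so multiplying
them by `r k → 0` gives limit 0. -/
theorem epiConverges_scale {n : ℕ} {v : E n → EReal} (hv : v ∈ ConvFin n) {r : ℕ → ℝ}
    (hr0 : Tendsto r atTop (𝓝 0)) :
    EpiConverges (fun k => scale (r k) v) fun _ => 0 := by
  obtain ⟨f, hf, hvf⟩ := exists_continuous_coe_of_mem_convFin hv
  intro x
  have key : ∀ y : ℕ → E n, Tendsto y atTop (𝓝 x) →
      Tendsto (fun k => scale (r k) v (y k)) atTop (𝓝 0) := by
    intro y hy
    simp only [scale, hvf, ← EReal.coe_mul]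
    refine (continuous_coe_real_ereal.tendsto 0).comp ?_
    simpa using hr0.mul ((hf.tendsto x).comp hy)
  exact ⟨fun y hy => (key y hy).liminf_eq.ge, fun _ => x, tendsto_const_nhds,
    key _ tendsto_const_nhds⟩

/-! ### Constancy of the functionals, and the converse -/

theorem IsEpiHomogeneous.eq_indicatorZero {n : ℕ} {Z : ConvSC n → ℝ} (hh : IsEpiHomogeneous 0 Z)
    (hc : IsEpiContinuous Z) (u : ConvSC n) : Z u = Z ⟨_, indicatorZero_mem n⟩ := by
  have hr : ∀ k : ℕ, (0 : ℝ) < 1 / ((k : ℝ) + 1) := fun k => Nat.one_div_pos_of_nat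
  have h := hc (fun k => ⟨_, epiMul_mem u.2 (hr k)⟩) ⟨_, indicatorZero_mem n⟩
    (epiConverges_epiMul u.2 hr tendsto_one_div_add_atTop_nhds_zero_nat)
  have he : ∀ k : ℕ, Z ⟨_, epiMul_mem u.2 (hr k)⟩ = Z u := fun k => by
    rw [hh u _ (hr k), Real.rpow_zero, one_mul]
  simp only [he] at h
  exact tendsto_nhds_unique tendsto_const_nhds h

theorem zero_mem_convFin (n : ℕ) : (fun _ : E n => (0 : EReal)) ∈ ConvFin n :=
  ⟨isConv_zero, fun _ => EReal.zero_lt_top⟩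

theorem IsPositivelyHomogeneous.eq_zero {n : ℕ} {Z : ConvFin n → ℝ}
    (hh : IsPositivelyHomogeneous 0 Z) (hc : IsEpiContinuous Z) (v : ConvFin n) :
    Z v = Z ⟨_, zero_mem_convFin n⟩ := by
  have hr : ∀ k : ℕ, (0 : ℝ) < 1 / ((k : ℝ) + 1) := fun k => Nat.one_div_pos_of_nat
  have h := hc (fun k => ⟨_, scale_mem v.2 (hr k).le⟩) ⟨_, zero_mem_convFin n⟩
    (epiConverges_scale v.2 tendsto_one_div_add_atTop_nhds_zero_nat)
  have he : ∀ k : ℕ, Z ⟨_, scale_mem v.2 (hr k).le⟩ = Z v := fun k => by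
    rw [hh v _ (hr k), Real.rpow_zero, one_mul]
  simp only [he] at h
  exact tendsto_nhds_unique tendsto_const_nhds h

theorem IsHomogeneous.isPositivelyHomogeneous {n : ℕ} {α : ℝ} {Z : ConvFin n → ℝ}
    (h : IsHomogeneous α Z) : IsPositivelyHomogeneous α Z := fun v r hr => h v r hr.le

theorem isEpiContinuous_of_const {n : ℕ} {X : Set (E n → EReal)} {Z : X → ℝ} {c : ℝ}
    (h : ∀ u, Z u = c) : IsEpiContinuous Z := fun u w _ => by
  simp only [h]
  exact tendsto_const_nhds

theorem isValuation_of_const {n : ℕ} {X : Set (E n → EReal)} {Z : X → ℝ} {c : ℝ}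
    (h : ∀ u, Z u = c) : IsValuation Z := fun u v _ _ => by simp only [h]

end ConvVal
open ConvVal in
theorem theorem7p1 (n : ℕ) :
    (∀ Z : ConvSC n → ℝ,
      (IsEpiContinuous Z ∧ IsValuation Z ∧ IsEpiTranslationInvariant Z ∧ IsEpiHomogeneous 0 Z) ↔
        ∃ c : ℝ, ∀ u, Z u = c) ∧
    (∀ Z : ConvFin n → ℝ,
      (IsEpiContinuous Z ∧ IsValuation Z ∧ IsDuallyEpiTranslationInvariant Z ∧
        IsHomogeneous 0 Z) ↔
        ∃ c : ℝ, ∀ v, Z v = c) ∧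
    (∀ Z : ConvFin n → ℝ,
      (IsEpiContinuous Z ∧ IsValuation Z ∧ IsDuallyEpiTranslationInvariant Z ∧
        IsPositivelyHomogeneous 0 Z) ↔
        ∃ c : ℝ, ∀ v, Z v = c) := by
  refine ⟨fun Z => ⟨fun ⟨hc, _, _, hh⟩ => ⟨_, hh.eq_indicatorZero hc⟩, ?_⟩,
    fun Z => ⟨fun ⟨hc, _, _, hh⟩ => ⟨_, hh.isPositivelyHomogeneous.eq_zero hc⟩, ?_⟩,
    fun Z => ⟨fun ⟨hc, _, _, hh⟩ => ⟨_, hh.eq_zero hc⟩, ?_⟩⟩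
  all_goals
    rintro ⟨c, h⟩
    refine ⟨isEpiContinuous_of_const h, isValuation_of_const h,
      ⟨fun _ _ => by simp only [h], fun _ _ => by simp only [h]⟩, fun _ r _ => ?_⟩
    -- `r ^ 0 = 1` holds at `r = 0` too, which covers homogeneity for all `r ≥ 0`.
    simp only [h, Real.rpow_zero, one_mul]
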